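/- Let $(X,d)$ be a CAT(0) space, i.e. a metric space in which any two points are joined by a geodesic and in which, for every geodesic triangle, the distance between any two points of the triangle is at most the distance between the corresponding points of the model triangle with the same side lengths in the Euclidean plane. Let $D>0$, and let $(P_i)_{i\ge 0}$, $(E_i)_{i\ge 0}$ be a discrete-time simple pursuit in $X$ with step size $D$: for every $i$, $d(E_i,E_{i+1})\le D$, and, as long as $d(P_i,E_i)>D$, $P_{i+1}$ is the point at distance $D$ from $P_i$ on a geodesic from $P_i$ to $E_i$. Suppose that the evader wins, meaning that $d(P_i,E_i)>D$ for all $i$ and that the limit $L=\lim_{i\to\infty} d(P_i,E_i)$ (of a nonincreasing sequence) also satisfies $L>D$. Let $E:[0,\infty)\to X$ be the evader curve, with $E(iD)=E_i$, which on each interval $[iD,(i+1)D]$ runs along a geodesic segment from $E_i$ to $E_{i+1}$ at constant speed $d(E_i,E_{i+1})/D\le 1$, and let $c(t)$ be its circumradius function, i.e. the smallest number such that $E([0,t])$ lies in the closed ball of radius $c(t)$ about $E(0)$. Then $c\in\Omega(t^{1/2})$: there are constants $A>0$ and $T\ge 0$ (which may depend on the given pursuit) such that $c(t)\ge A\,t^{1/2}$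 for all $t\ge T$. -/

import Mathlib

open Filter Topology Asymptotics Set

/-- `σ`, restricted to `[0, dist p q]`, is a (unit speed) geodesic from `p` to `q`. -/
structure IsGeodesicFromTo {X : Type*} [MetricSpace X] (σ : ℝ → X) (p q : X) : Prop where
  source : σ 0 = p
  target : σ (dist p q) = q
  isometric : ∀ s ∈ Icc (0 : ℝ) (dist p q), ∀ t ∈ Icc (0 : ℝ) (dist p q),
    dist (σ s) (σ t) = |s - t|

/-- Any two points are joined by a geodesic. -/
def IsGeodesicSpace (X : Type*) [MetricSpace X] : Prop :=
  ∀ p q : X, ∃ σ : ℝ → X, IsGeodesicFromTo σ p q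

/-- A geodesic triangle with vertices `v 0, v 1, v 2`, the `i`-th side being the geodesic `σ i`
from `v i` to `v (i + 1)` (indices modulo `3`). -/
def IsGeodesicTriangle {X : Type*} [MetricSpace X] (v : Fin 3 → X) (σ : Fin 3 → ℝ → X) : Prop :=
  ∀ i, IsGeodesicFromTo (σ i) (v i) (v (i + 1))

/-- A CAT(0) space: a geodesic metric space in which the distance between any two points of a
geodesic triangle is at most the distance between the corresponding points of the model triangle
with the same side lengths in the Euclidean plane. -/
def IsCAT0 (X : Type*) [MetricSpace X] : Prop :=
  IsGeodesicSpace X ∧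
    ∀ (v : Fin 3 → X) (σ : Fin 3 → ℝ → X)
      (w : Fin 3 → EuclideanSpace ℝ (Fin 2)) (τ : Fin 3 → ℝ → EuclideanSpace ℝ (Fin 2)),
      IsGeodesicTriangle v σ → IsGeodesicTriangle w τ →
      (∀ i, dist (w i) (w (i + 1)) = dist (v i) (v (i + 1))) →
      ∀ i j : Fin 3, ∀ s ∈ Icc (0 : ℝ) (dist (v i) (v (i + 1))),
        ∀ t ∈ Icc (0 : ℝ) (dist (v j) (v (j + 1))),
          dist (σ i s) (σ j t) ≤ dist (τ i s) (τ j t)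

/-- Discrete-time simple pursuit with step size `D`: the evader moves by at most `D` at every step,
and, as long as the evader is not captured (that is, farther than `D`), the pursuer moves by exactly
`D` along a geodesic towards the present position of the evader. -/
structure IsSimplePursuit {X : Type*} [MetricSpace X] (D : ℝ) (P E : ℕ → X) : Prop where
  evader_step : ∀ i, dist (E i) (E (i + 1)) ≤ D
  pursuer_step : ∀ i, D < dist (P i) (E i) →
    ∃ σ : ℝ → X, IsGeodesicFromTo σ (P i) (E i) ∧ P (i + 1) = σ D

/-- The evader wins: the distance to the pursuer is never at most `D`, nor is it so in the limit,
i.e. the limit of the (nonincreasing) distances is greater than `D`. -/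
def EvaderWins {X : Type*} [MetricSpace X] (D : ℝ) (P E : ℕ → X) : Prop :=
  (∀ i, D < dist (P i) (E i)) ∧
    ∃ L : ℝ, Tendsto (fun i => dist (P i) (E i)) atTop (𝓝 L) ∧ D < L

/-- `γ : [0, ∞) → X` is the discrete-time evader curve through the points `E i`: it passes through
`E i` at time `i * D`, and on each time interval `[i * D, (i + 1) * D]` it runs along a geodesic
segment from `E i` to `E (i + 1)` with constant speed `dist (E i) (E (i + 1)) / D`. -/
structure IsEvaderCurve {X : Type*} [MetricSpace X] (D : ℝ) (E : ℕ → X) (γ : ℝ → X) : Prop where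
  vertex : ∀ i : ℕ, γ (i * D) = E i
  segment : ∀ i : ℕ, ∀ s ∈ Icc (i * D) ((i + 1) * D), ∀ t ∈ Icc (i * D) ((i + 1) * D),
    dist (γ s) (γ t) = dist (E i) (E (i + 1)) / D * |s - t|

/-- The circumradius function of a curve `γ` on `[0, ∞)`: the smallest `r` such that `γ` maps
`[0, t]` into the closed ball of radius `r` about `γ 0`. -/
noncomputable def circumradius {X : Type*} [MetricSpace X] (γ : ℝ → X) (t : ℝ) : ℝ :=
  sInf {r : ℝ | γ '' Icc 0 t ⊆ Metric.closedBall (γ 0) r}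

/-- For a curve that is bounded on `[0, t]`, the infimum is attained. -/
theorem circumradius_isLeast {X : Type*} [MetricSpace X] {γ : ℝ → X} {t : ℝ} (ht : 0 ≤ t)
    (hb : Bornology.IsBounded (γ '' Icc 0 t)) :
    IsLeast {r : ℝ | γ '' Icc 0 t ⊆ Metric.closedBall (γ 0) r} (circumradius γ t) := by
  have hne : {r : ℝ | γ '' Icc 0 t ⊆ Metric.closedBall (γ 0) r}.Nonempty :=
    hb.subset_closedBall (γ 0)
  refine ⟨?_, fun r hr => csInf_le ⟨0, fun r hr => ?_⟩ hr⟩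
  · intro x hx
    exact le_csInf hne fun r hr => hr hx
  · have := hr ⟨0, ⟨le_refl _, ht⟩, rfl⟩
    simpa using this

/-! A pursuer who never closes in must run almost straight, and an almost straight path escapes
every ball. Write `d i = dist (P i) (E i)` and `δ i = d i - d (i + 1) ≥ 0`; the `δ i` sum to at most
`d 0`. By `IsCAT0.hinge`, the pursuer's path bends at `P (i + 1)` by an amount of order `√(δ i)`. On
a straight path, Stewart's inequality makes the second differences of `dist o (P i) ^ 2` at least `2
* D ^ 2`; the bends cost `O(R √(δ i))` while the path stays within `R` of `o` (`second_difference`).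
Summing over `n` steps with `o = E 0` telescopes the left side to `O(R)`, and Cauchy–Schwarz bounds
the errors by `O(R √n)` (`card_steps_le`). Hence `n = O(R √n)`. The pursuer stays within `d 0` of
the evader, so the evader also travels a distance of order `√n`. -/

/-! ### Comparison inequalities in CAT(0) spaces -/

theorem IsGeodesicFromTo.subsegment {X : Type*} [MetricSpace X] {σ : ℝ → X} {p q : X}
    (h : IsGeodesicFromTo σ p q) {u v : ℝ} (hu : 0 ≤ u) (huv : u ≤ v) (hv : v ≤ dist p q) :
    dist (σ u) (σ v) = v - u ∧ IsGeodesicFromTo (fun s => σ (u + s)) (σ u) (σ v) := by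
  have hd : dist (σ u) (σ v) = v - u := by
    rw [h.isometric u ⟨hu, huv.trans hv⟩ v ⟨hu.trans huv, hv⟩, abs_sub_comm,
      abs_of_nonneg (by linarith)]
  refine ⟨hd, by simp, by simp [hd], ?_⟩
  rintro s ⟨hs, hs'⟩ t ⟨ht, ht'⟩
  rw [hd] at hs' ht'
  rw [h.isometric (u + s) ⟨by linarith, by linarith⟩ (u + t) ⟨by linarith, by linarith⟩]
  congr 1
  ring

/-- The affine segment between two points of a normed space, parametrized by arc length. -/
theorem exists_geodesic_normedSpace {V : Type*} [NormedAddCommGroup V] [NormedSpace ℝ V]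
    (a b : V) : IsGeodesicFromTo (fun s : ℝ => a + (s / dist a b) • (b - a)) a b := by
  rcases eq_or_ne a b with rfl | hab
  · refine ⟨by simp, by simp, ?_⟩
    rintro s ⟨hs, hs'⟩ t ⟨ht, ht'⟩
    rw [dist_self] at hs' ht'
    simp [le_antisymm hs' hs, le_antisymm ht' ht]
  · have hpos : 0 < dist a b := dist_pos.2 hab
    refine ⟨by simp, by simp [hpos.ne'], ?_⟩
    rintro s - t -
    rw [dist_add_left, dist_eq_norm, ← sub_smul, norm_smul, ← dist_eq_norm b a, dist_comm b a,
      Real.norm_eq_abs, ← sub_div, abs_div, abs_of_pos hpos]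
    field_simp

/-- A Euclidean triangle with prescribed side lengths. -/
theorem exists_comparison_triangle {l p q : ℝ} (hl : 0 < l) (hp : 0 ≤ p) (hq : 0 ≤ q)
    (h₁ : l ≤ p + q) (h₂ : p ≤ l + q) (h₃ : q ≤ l + p) :
    ∃ a b c : EuclideanSpace ℝ (Fin 2), dist a b = p ∧ dist b c = l ∧ dist c a = q := by
  -- With `b` at the origin and `c` on the first axis, the law of cosines gives the abscissa of `a`.
  set x := (p ^ 2 + l ^ 2 - q ^ 2) / (2 * l) with hx
  have hxl : 2 * l * x = p ^ 2 + l ^ 2 - q ^ 2 := by rw [hx]; field_simp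
  have hxp : x ^ 2 ≤ p ^ 2 := by
    apply sq_le_sq'
    · rw [hx, le_div_iff₀ (by positivity)]
      nlinarith
    · rw [hx, div_le_iff₀ (by positivity)]
      nlinarith
  have hy : √(p ^ 2 - x ^ 2) ^ 2 = p ^ 2 - x ^ 2 := Real.sq_sqrt (by linarith)
  refine ⟨!₂[x, √(p ^ 2 - x ^ 2)], !₂[0, 0], !₂[l, 0], ?_, ?_, ?_⟩
  · rw [EuclideanSpace.dist_eq, Real.sqrt_eq_iff_mul_self_eq (by positivity) hp]
    simp [Fin.sum_univ_two, Real.dist_eq, hy]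
    ring
  · rw [EuclideanSpace.dist_eq, Real.sqrt_eq_iff_mul_self_eq (by positivity) hl.le]
    simp [Fin.sum_univ_two, Real.dist_eq]
    ring
  · rw [EuclideanSpace.dist_eq, Real.sqrt_eq_iff_mul_self_eq (by positivity) hq]
    simp [Fin.sum_univ_two, Real.dist_eq, hy]
    linarith

/-- Stewart's identity for a point on a segment of a Euclidean space. -/
theorem stewart_euclidean {V : Type*} [NormedAddCommGroup V] [InnerProductSpace ℝ V]
    {a b c : V} (h : 0 < dist b c) (s : ℝ) :
    dist b c * dist a (b + (s / dist b c) • (c - b)) ^ 2 =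
      (dist b c - s) * dist a b ^ 2 + s * dist a c ^ 2 - s * (dist b c - s) * dist b c := by
  have h₁ : dist a (b + (s / dist b c) • (c - b)) ^ 2 = dist a b ^ 2
      - 2 * (s / dist b c) * inner ℝ (a - b) (c - b) + (s / dist b c) ^ 2 * dist b c ^ 2 := by
    rw [dist_eq_norm a, ← sub_sub, norm_sub_sq_real, inner_smul_right, norm_smul, mul_pow,
      Real.norm_eq_abs, sq_abs, ← dist_eq_norm a b, ← dist_eq_norm c b, dist_comm c b]
    ring
  have h₂ : dist a c ^ 2 = dist a b ^ 2 - 2 * inner ℝ (a - b) (c - b) + dist b c ^ 2 := by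
    rw [dist_eq_norm a c, ← sub_sub_sub_cancel_right a c b, norm_sub_sq_real,
      ← dist_eq_norm a b, ← dist_eq_norm c b, dist_comm c b]
  rw [h₁, h₂]
  field_simp
  ring

/-- Stewart's inequality in a CAT(0) space. -/
theorem IsCAT0.stewart {X : Type*} [MetricSpace X] (hX : IsCAT0 X) {σ : ℝ → X} {p q : X}
    (hσ : IsGeodesicFromTo σ p q) (o : X) {l s : ℝ} (hl : dist p q = l) (hl0 : 0 < l)
    (hs : 0 ≤ s) (hsl : s ≤ l) :
    l * dist o (σ s) ^ 2 ≤ (l - s) * dist o p ^ 2 + s * dist o q ^ 2 - s * (l - s) * l := by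
  subst hl
  obtain ⟨a, b, c, hab, hbc, hca⟩ := exists_comparison_triangle hl0 (dist_nonneg (x := o) (y := p))
    (dist_nonneg (x := q) (y := o))
    (by rw [dist_comm o p, dist_comm q o]; exact dist_triangle _ _ _)
    (by rw [dist_comm o p, add_comm, ← sub_le_iff_le_add, sub_le_iff_le_add']
        linarith [dist_triangle p q o])
    (by linarith [dist_triangle q p o, dist_comm p q, dist_comm p o])
  obtain ⟨σ₀, hσ₀⟩ := hX.1 o p
  obtain ⟨σ₂, hσ₂⟩ := hX.1 q o
  have key := hX.2 ![o, p, q] ![σ₀, σ, σ₂] ![a, b, c]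
    ![fun s => a + (s / dist a b) • (b - a), fun s => b + (s / dist b c) • (c - b),
      fun s => c + (s / dist c a) • (a - c)]
    (by intro i; fin_cases i <;> simpa)
    (by intro i; fin_cases i <;> exact exists_geodesic_normedSpace _ _)
    (by intro i; fin_cases i <;> simpa) 0 1 0 ⟨le_rfl, dist_nonneg⟩ s ⟨hs, hsl⟩
  have key' : dist o (σ s) ≤ dist a (b + (s / dist b c) • (c - b)) := by
    simpa [hσ₀.source] using key
  have hst := stewart_euclidean (a := a) (hbc ▸ hl0) s
  rw [hbc, hab, dist_comm a c, hca, dist_comm q o] at hst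
  rw [hbc] at key'
  calc _ ≤ dist p q * dist a (b + (s / dist p q) • (c - b)) ^ 2 := by gcongr
    _ = _ := hst

/-- Two geodesics with a common origin in a CAT(0) space: comparison of the distance of the points
at distance `h` from the origin. -/
theorem IsCAT0.hinge {X : Type*} [MetricSpace X] (hX : IsCAT0 X) {σ τ : ℝ → X} {o p q : X}
    (hσ : IsGeodesicFromTo σ o p) (hτ : IsGeodesicFromTo τ o q) {h : ℝ} (h0 : 0 < h)
    (hp : h ≤ dist o p) (hq : h ≤ dist o q) :
    dist o p * dist o q * dist (σ h) (τ h) ^ 2 ≤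
      h ^ 2 * (dist p q ^ 2 - (dist o p - dist o q) ^ 2) := by
  -- Stewart twice: from `p` to the side `τ`, then from `τ h` to the side `σ`. In the plane both are
  -- equalities, and the bound is the law of cosines.
  have h₁ := hX.stewart hτ p rfl (h0.trans_le hq) h0.le hq
  have h₂ := hX.stewart hσ (τ h) rfl (h0.trans_le hp) h0.le hp
  have h₃ : dist (τ h) o = h := by
    have := (hτ.subsegment le_rfl h0.le hq).1
    rwa [hτ.source, sub_zero, dist_comm] at this
  rw [h₃, dist_comm (τ h) p] at h₂
  rw [dist_comm p o] at h₁
  rw [dist_comm (σ h)]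
  have hb : 0 < dist o q := h0.trans_le hq
  nlinarith [mul_le_mul_of_nonneg_left h₂ hb.le, mul_le_mul_of_nonneg_left h₁ h0.le]

/-! ### Convexity along the pursuer's path -/

namespace IsSimplePursuit

variable {X : Type*} [MetricSpace X] {D : ℝ} {P E : ℕ → X}

theorem dist_pursuer_step (hPE : IsSimplePursuit D P E) (hD : 0 < D) {i : ℕ}
    (hi : D < dist (P i) (E i)) :
    dist (P i) (P (i + 1)) = D ∧ dist (P (i + 1)) (E i) = dist (P i) (E i) - D := by
  obtain ⟨σ, hσ, hP⟩ := hPE.pursuer_step i hi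
  have h₁ := (hσ.subsegment le_rfl hD.le hi.le).1
  have h₂ := (hσ.subsegment hD.le hi.le le_rfl).1
  rw [hσ.source, ← hP, sub_zero] at h₁
  rw [hσ.target, ← hP] at h₂
  exact ⟨h₁, h₂⟩

/-- The pursuer's move gains exactly `D`, and the evader's move restores at most `D`. -/
theorem antitone_dist (hPE : IsSimplePursuit D P E) (hD : 0 < D)
    (hwin : ∀ i, D < dist (P i) (E i)) : Antitone fun i => dist (P i) (E i) := by
  refine antitone_nat_of_succ_le fun i => ?_
  have h₁ := (hPE.dist_pursuer_step hD (hwin i)).2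
  linarith [dist_triangle (P (i + 1)) (E i) (E (i + 1)), hPE.evader_step i]

/-- The squared distances of the pursuer to a fixed point are almost uniformly convex in time. -/
theorem second_difference (hPE : IsSimplePursuit D P E) (hX : IsCAT0 X) (hD : 0 < D) {h : ℝ}
    (h0 : 0 < h) (hhD : h ≤ D) (hh : ∀ i, D + h ≤ dist (P i) (E i)) (o : X) {i : ℕ} {R : ℝ}
    (hR : dist o (P i) + 2 * D ≤ R) :
    2 * D ^ 2 - 2 * R * (D / h) * √(2 * D * (dist (P i) (E i) - dist (P (i + 1)) (E (i + 1)))) ≤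
      dist o (P (i + 2)) ^ 2 - 2 * dist o (P (i + 1)) ^ 2 + dist o (P i) ^ 2 := by
  have hwin : ∀ i, D < dist (P i) (E i) := fun i => by linarith [hh i]
  obtain ⟨σ, hσ, hP₁⟩ := hPE.pursuer_step i (hwin i)
  obtain ⟨τ, hτ, hP₂⟩ := hPE.pursuer_step (i + 1) (hwin _)
  have hd₁ := hPE.dist_pursuer_step hD (hwin i)
  have hd₂ := hPE.dist_pursuer_step hD (hwin (i + 1))
  have hanti := hPE.antitone_dist hD hwin (Nat.le_succ i)
  have hstep := hPE.evader_step i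
  have hi := hh i
  have hi' := hh (i + 1)
  simp only [Nat.succ_eq_add_one] at hanti
  set δ := dist (P i) (E i) - dist (P (i + 1)) (E (i + 1)) with hδ
  have hseg := hσ.subsegment hD.le (hwin i).le le_rfl
  rw [hσ.target, ← hP₁] at hseg
  have hhinge := hX.hinge hseg.2 hτ h0 (by linarith) (by linarith)
  rw [hd₁.2] at hhinge
  -- The hinge at `P (i + 1)` joins the continuation of `σ` to the new geodesic `τ`. Its sides
  -- differ by `D - δ` and its base is at most `D`, and `D ^ 2 - (D - δ) ^ 2 ≤ 2 * D * δ`.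
  have hε : dist (σ (D + h)) (τ h) ≤ √(2 * D * δ) := by
    apply Real.le_sqrt_of_sq_le
    have hab : h ^ 2 ≤ (dist (P i) (E i) - D) * dist (P (i + 1)) (E (i + 1)) := by
      rw [sq]
      exact mul_le_mul (by linarith) (by linarith) h0.le (by linarith)
    have hsq : dist (E i) (E (i + 1)) ^ 2 ≤ D ^ 2 := by gcongr
    refine le_of_mul_le_mul_left ?_ (sq_pos_of_pos h0)
    calc h ^ 2 * dist (σ (D + h)) (τ h) ^ 2
        ≤ (dist (P i) (E i) - D) * dist (P (i + 1)) (E (i + 1)) * dist (σ (D + h)) (τ h) ^ 2 := by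
          gcongr
      _ ≤ _ := hhinge
      _ ≤ h ^ 2 * (2 * D * δ) := by
          gcongr
          nlinarith [sq_nonneg δ]
  have h₁ : dist o (P (i + 1)) ≤ dist o (P i) + D := by
    linarith [dist_triangle o (P i) (P (i + 1))]
  have hτh : dist (P (i + 1)) (τ h) = h := by
    have := (hτ.subsegment le_rfl h0.le (by linarith)).1
    rwa [hτ.source, sub_zero] at this
  have hσh : dist (P i) (σ (D + h)) = D + h := by
    have := (hσ.subsegment le_rfl (by linarith) hi).1
    rwa [hσ.source, sub_zero] at this
  have h₂ : dist o (τ h) ≤ R := by linarith [dist_triangle o (P (i + 1)) (τ h)]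
  have h₃ : dist o (σ (D + h)) ≤ R := by linarith [dist_triangle o (P i) (σ (D + h))]
  have herr : dist o (σ (D + h)) ^ 2 ≤ dist o (τ h) ^ 2 + 2 * R * √(2 * D * δ) := by
    have h₄ : dist o (σ (D + h)) - dist o (τ h) ≤ √(2 * D * δ) := by
      linarith [dist_triangle o (τ h) (σ (D + h)), dist_comm (τ h) (σ (D + h))]
    have h₅ : 0 ≤ dist o (σ (D + h)) + dist o (τ h) := by positivity
    nlinarith [mul_le_mul_of_nonneg_right h₄ h₅, Real.sqrt_nonneg (2 * D * δ)]
  -- Stewart at `P (i + 1)` on `σ` and at `τ h` on `τ`; `herr` links the auxiliary points `σ (D +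
  -- h)` and `τ h`, which then drop out of the sum.
  have hs₁ : (D + h) * dist o (P (i + 1)) ^ 2 ≤
      h * dist o (P i) ^ 2 + D * dist o (σ (D + h)) ^ 2 - D * h * (D + h) := by
    have hsub := (hσ.subsegment le_rfl (by linarith : 0 ≤ D + h) hi).2
    rw [hσ.source] at hsub
    have := hX.stewart hsub o hσh (by linarith) hD.le (by linarith)
    rw [zero_add, ← hP₁] at this
    linarith
  have hs₂ : D * dist o (τ h) ^ 2 ≤
      (D - h) * dist o (P (i + 1)) ^ 2 + h * dist o (P (i + 2)) ^ 2 - h * (D - h) * D := by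
    have hsub := (hτ.subsegment le_rfl hD.le (hwin _).le).2
    rw [hτ.source, ← hP₂] at hsub
    have := hX.stewart hsub o hd₂.1 hD h0.le hhD
    rwa [zero_add] at this
  refine le_of_mul_le_mul_left ?_ h0
  have hcancel : h * (2 * R * (D / h) * √(2 * D * δ)) = D * (2 * R * √(2 * D * δ)) := by
    field_simp
  rw [mul_sub, hcancel]
  nlinarith [mul_le_mul_of_nonneg_left herr hD.le]

/-- A bound for the number of steps during which the evader stays in a ball of radius `M`. -/
theorem card_steps_le (hPE : IsSimplePursuit D P E) (hX : IsCAT0 X) (hD : 0 < D) {h : ℝ}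
    (h0 : 0 < h) (hhD : h ≤ D) (hh : ∀ i, D + h ≤ dist (P i) (E i)) {n : ℕ} {M : ℝ}
    (hM : ∀ i ≤ n, dist (E 0) (E i) ≤ M) :
    2 * D ^ 2 * n ≤ (M + dist (P 0) (E 0) + 2 * D) *
      (4 * D + 2 * (D / h) * (√(2 * D * dist (P 0) (E 0)) * √n)) := by
  have hwin : ∀ i, D < dist (P i) (E i) := fun i => by linarith [hh i]
  have hanti := hPE.antitone_dist hD hwin
  set R := M + dist (P 0) (E 0) + 2 * D with hRdef
  have hR : ∀ i ≤ n, dist (E 0) (P i) + 2 * D ≤ R := fun i hi => by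
    have h₁ : dist (P i) (E i) ≤ dist (P 0) (E 0) := hanti (Nat.zero_le i)
    linarith [dist_triangle (E 0) (E i) (P i), dist_comm (E i) (P i), hM i hi]
  have hR0 : 0 ≤ R := by
    linarith [hR 0 (Nat.zero_le n), dist_nonneg (x := E 0) (y := P 0)]
  have hdiff : ∀ i ≤ n, |dist (E 0) (P (i + 1)) ^ 2 - dist (E 0) (P i) ^ 2| ≤ 2 * R * D := by
    intro i hi
    have hd := (hPE.dist_pursuer_step hD (hwin i)).1
    have h₁ : |dist (E 0) (P (i + 1)) - dist (E 0) (P i)| ≤ D := by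
      rw [dist_comm (E 0), dist_comm (E 0), ← hd, dist_comm (P i) (P (i + 1))]
      exact abs_dist_sub_le _ _ _
    have h₂ : dist (E 0) (P (i + 1)) + dist (E 0) (P i) ≤ 2 * R := by
      linarith [hR i hi, dist_triangle (E 0) (P i) (P (i + 1))]
    rw [sq_sub_sq, abs_mul, abs_of_nonneg (by positivity)]
    exact mul_le_mul h₂ h₁ (abs_nonneg _) (by positivity)
  set δ : ℕ → ℝ := fun i => dist (P i) (E i) - dist (P (i + 1)) (E (i + 1)) with hδ
  have hδ0 : ∀ i, 0 ≤ 2 * D * δ i := fun i =>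
    mul_nonneg (by positivity) (sub_nonneg.2 (hanti (Nat.le_succ i)))
  have hsum := Finset.sum_le_sum fun i (hi : i ∈ Finset.range n) =>
    hPE.second_difference hX hD h0 hhD hh (E 0) (hR i (Finset.mem_range.1 hi).le)
  -- Only two first differences survive, each at most `2 * R * D` in size by `hdiff`.
  have htel : ∑ i ∈ Finset.range n, (dist (E 0) (P (i + 2)) ^ 2 - 2 * dist (E 0) (P (i + 1)) ^ 2
      + dist (E 0) (P i) ^ 2) = (dist (E 0) (P (n + 1)) ^ 2 - dist (E 0) (P n) ^ 2)
        - (dist (E 0) (P (0 + 1)) ^ 2 - dist (E 0) (P 0) ^ 2) := by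
    rw [← Finset.sum_range_sub (fun i => dist (E 0) (P (i + 1)) ^ 2 - dist (E 0) (P i) ^ 2)]
    exact Finset.sum_congr rfl fun i _ => by ring
  -- Cauchy–Schwarz, with the telescoping sum of the `δ i` at most `dist (P 0) (E 0)`.
  have hcs : ∑ i ∈ Finset.range n, √(2 * D * δ i) ≤ √(2 * D * dist (P 0) (E 0)) * √n := by
    rw [← Real.sqrt_mul (by positivity)]
    apply Real.le_sqrt_of_sq_le
    refine sq_sum_le_card_mul_sum_sq.trans ?_
    simp only [Real.sq_sqrt (hδ0 _), Finset.card_range, ← Finset.mul_sum]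
    have : ∑ i ∈ Finset.range n, δ i ≤ dist (P 0) (E 0) := by
      rw [hδ, Finset.sum_range_sub' fun i => dist (P i) (E i)]
      linarith [dist_nonneg (x := P n) (y := E n)]
    rw [mul_comm]
    gcongr
  rw [htel, Finset.sum_sub_distrib, ← Finset.mul_sum, Finset.sum_const, Finset.card_range,
    nsmul_eq_mul] at hsum
  have hlast := (abs_le.1 (hdiff n le_rfl)).2
  have hfirst := (abs_le.1 (hdiff 0 (Nat.zero_le n))).1
  have hmul := mul_le_mul_of_nonneg_left hcs (by positivity : 0 ≤ 2 * R * (D / h))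
  rw [Finset.mul_sum] at hmul
  linarith

end IsSimplePursuit

/-! ### From evader steps to the circumradius -/

/-- Ensures that the infimum defining `circumradius` is not the default value `sInf ∅ = 0`. -/
theorem IsEvaderCurve.isBounded_image {X : Type*} [MetricSpace X] {D : ℝ} (hD : 0 < D)
    {E : ℕ → X} {γ : ℝ → X} (hγ : IsEvaderCurve D E γ) (t : ℝ) :
    Bornology.IsBounded (γ '' Icc 0 t) := by
  have hfin : (Finset.range (⌊t / D⌋₊ + 1) : Set ℕ).Finite := Finset.finite_toSet _
  refine ((Bornology.isBounded_biUnion hfin).2 fun i _ =>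
    Metric.isBounded_closedBall (x := E i) (r := dist (E i) (E (i + 1)))).subset ?_
  rintro _ ⟨s, ⟨hs, hst⟩, rfl⟩
  have hsD : 0 ≤ s / D := by positivity
  have h₁ : (⌊s / D⌋₊ : ℝ) * D ≤ s := (le_div_iff₀ hD).1 (Nat.floor_le hsD)
  have h₂ : s ≤ ((⌊s / D⌋₊ : ℝ) + 1) * D := ((div_lt_iff₀ hD).1 (Nat.lt_floor_add_one _)).le
  refine mem_biUnion (x := ⌊s / D⌋₊) ?_ ?_
  · have : ⌊s / D⌋₊ ≤ ⌊t / D⌋₊ := Nat.floor_le_floor (by gcongr)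
    simpa [Nat.lt_succ_iff] using this
  · rw [Metric.mem_closedBall, ← hγ.vertex ⌊s / D⌋₊,
      hγ.segment ⌊s / D⌋₊ s ⟨h₁, h₂⟩ _ ⟨le_rfl, by linarith⟩, hγ.vertex]
    rw [div_mul_eq_mul_div, div_le_iff₀ hD, abs_of_nonneg (by linarith)]
    gcongr
    linarith

theorem IsEvaderCurve.dist_le_circumradius {X : Type*} [MetricSpace X] {D : ℝ} (hD : 0 < D)
    {E : ℕ → X} {γ : ℝ → X} (hγ : IsEvaderCurve D E γ) {t : ℝ} {i : ℕ} (hi : i * D ≤ t) :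
    dist (E 0) (E i) ≤ circumradius γ t := by
  have hi0 : 0 ≤ i * D := by positivity
  have h := (circumradius_isLeast (hi0.trans hi) (hγ.isBounded_image hD t)).1
    (mem_image_of_mem γ ⟨hi0, hi⟩)
  have hγ0 : γ 0 = E 0 := by simpa using hγ.vertex 0
  rwa [Metric.mem_closedBall, hγ.vertex, hγ0, dist_comm] at h

theorem mainTheorem5 {X : Type*} [MetricSpace X] (hX : IsCAT0 X)
    (D : ℝ) (hD : 0 < D) (P E : ℕ → X) (hPE : IsSimplePursuit D P E)
    (γ : ℝ → X) (hγ : IsEvaderCurve D E γ) (hwin : EvaderWins D P E) :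
    (fun t : ℝ => t ^ (1 / 2 : ℝ)) =O[atTop] circumradius γ := by
  obtain ⟨hfar, L, hL, hDL⟩ := hwin
  -- `h ≤ L - D` lets every pursuit geodesic continue by `h` past the pursuer's step; `h ≤ D` keeps
  -- `τ h` within the next step.
  set h := min D (L - D) with hdef
  have h0 : 0 < h := lt_min hD (by linarith)
  have hh : ∀ i, D + h ≤ dist (P i) (E i) := fun i => by
    linarith [(hPE.antitone_dist hD hfar).le_of_tendsto hL i, min_le_right D (L - D)]
  set K := 4 * D + 2 * (D / h) * √(2 * D * dist (P 0) (E 0)) with hK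
  have hK0 : 0 < K := by positivity
  set B := dist (P 0) (E 0) + 2 * D with hB
  have hB0 : 0 < B := by positivity
  -- With `n = ⌊t / D⌋`, the number of steps is controlled by `D² √n ≤ K (c + B)`.
  have hmain : ∀ t, D ≤ t → D ^ 2 * √(t / D) ≤ K * (circumradius γ t + B) := by
    intro t ht
    have htD : 1 ≤ t / D := (one_le_div₀ hD).2 ht
    set n := ⌊t / D⌋₊ with hn
    have hn1 : (1 : ℝ) ≤ n := by exact_mod_cast Nat.le_floor (by simpa using htD)
    have hsn1 : 1 ≤ √(n : ℝ) := Real.one_le_sqrt.2 hn1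
    have hnt : n * D ≤ t := (le_div_iff₀ hD).1 (Nat.floor_le (by linarith))
    have hM : ∀ i ≤ n, dist (E 0) (E i) ≤ circumradius γ t := fun i hi =>
      hγ.dist_le_circumradius hD (le_trans (by gcongr) hnt)
    have hc0 : 0 ≤ circumradius γ t := dist_nonneg.trans (hM 0 (Nat.zero_le n))
    have hcard := hPE.card_steps_le hX hD h0 (min_le_left _ _) hh hM
    rw [add_assoc, ← hB] at hcard
    -- The constant `4 * D` is absorbed because `√n ≥ 1`.
    have hle : 4 * D + 2 * (D / h) * (√(2 * D * dist (P 0) (E 0)) * √n) ≤ K * √n := by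
      rw [hK]
      nlinarith
    have hcard' : 2 * D ^ 2 * n ≤ (circumradius γ t + B) * (K * √n) :=
      hcard.trans (by gcongr)
    have hsq : √(n : ℝ) * √n = n := Real.mul_self_sqrt (by positivity)
    have hs : 2 * D ^ 2 * √n ≤ K * (circumradius γ t + B) := by
      refine le_of_mul_le_mul_right ?_ (lt_of_lt_of_le one_pos hsn1)
      calc 2 * D ^ 2 * √n * √n = 2 * D ^ 2 * n := by rw [mul_assoc, hsq]
        _ ≤ _ := hcard'
        _ = _ := by ring
    -- Here `t / D < n + 1 ≤ 4 * n`.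
    have hroot : √(t / D) ≤ 2 * √n := by
      rw [Real.sqrt_le_left (by positivity), mul_pow, Real.sq_sqrt (by positivity)]
      linarith [Nat.lt_floor_add_one (t / D)]
    nlinarith [mul_le_mul_of_nonneg_left hroot (sq_nonneg D)]
  have htend : Tendsto (fun t : ℝ => √(t / D)) atTop atTop :=
    Real.tendsto_sqrt_atTop.comp (tendsto_id.atTop_div_const hD)
  refine IsBigO.of_bound (2 * K * √D / D ^ 2) ?_
  -- Beyond this threshold `K * B` is at most half of `D ^ 2 * √(t / D)`, at the price of a factor
  -- `2`.
  filter_upwards [eventually_ge_atTop D, htend.eventually_ge_atTop (2 * K * B / D ^ 2)]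
    with t ht htB
  have hbound := hmain t ht
  rw [div_le_iff₀ (by positivity)] at htB
  have hc : D ^ 2 * √(t / D) ≤ 2 * K * circumradius γ t := by linarith
  have hc0 : 0 ≤ circumradius γ t :=
    dist_nonneg.trans (hγ.dist_le_circumradius hD (i := 0) (by simpa using hD.le.trans ht))
  rw [← Real.sqrt_eq_rpow, Real.norm_of_nonneg (Real.sqrt_nonneg t), Real.norm_of_nonneg hc0]
  have hst : √t = √(t / D) * √D := by
    rw [← Real.sqrt_mul (div_nonneg (hD.le.trans ht) hD.le), div_mul_cancel₀ _ hD.ne']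
  rw [hst, div_mul_eq_mul_div, le_div_iff₀ (by positivity)]
  nlinarith [mul_le_mul_of_nonneg_right hc (Real.sqrt_nonneg D)]
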